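/- Let $0<r<1$ and let $\mathcal H$ be a complex Hilbert space. Let $C_{1,r}$ be the class of invertible operators $T$ with $\|T\|\le 1$ and $\|rT^{-1}\|\le 1$, and let $\mathcal C_{1,r}$ be the class of operators $J$ for which there are orthogonal projections $P_0,P_1$ with $P_0+P_1=I$ and $J^*J=P_0+r^2P_1$. A tuple $(T_1,\dots,T_d)$ is doubly commuting if $T_iT_j=T_jT_i$ and $T_iT_j^*=T_j^*T_i$ for $i\ne j$. Put $\mathbb D=\{|z|<1\}$, $\mathbb T=\{|z|=1\}$, $\mathbb T^{\pm}=\{z\in\mathbb T:\pm\operatorname{Im}z>0\}$ and $\mathbb A_r=\{z\in\mathbb C: r<|z|<1\}$; $\mathbb T$ carries normalized arc length measure. **Theorem 2.5.** Let $(T_1,\dots,T_d)$ be a doubly commuting tuple of operators in $C_{1,r}$ acting on $\mathcal H$, and suppose that for each $j$ the spectrum $\sigma(D_j)$ of $D_j=(T_j^*T_j)^{1/2}$ is a finite subset of $(r,1)$. Put $U_j=T_jD_j^{-1}$. Let $\mathcal K=L^2(\mathbb T)\otimes\mathcal H$, realized as $L^2(\mathbb T;\mathcal H)$ with $(f\otimes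 h)(\zeta)=f(\zeta)h$, and let $V:\mathcal H\to\mathcal K$ be the isometry $Vh=1\otimes h$. Then there exist 1. a function $v$, analytic on $\mathbb D$, with $v(\mathbb D)=\mathbb A_r$ and $v(0)=\sqrt r$, which extends continuously to $\overline{\mathbb D}\setminus\{1,-1\}$ with $v(\mathbb T^+)=r\mathbb T$ and $v(\mathbb T^-)=\mathbb T$; 2. points $w_{j,\lambda}\in\mathbb D$ with $v(w_{j,\lambda})=\lambda$, for $1\le j\le d$ and $\lambda\in\sigma(D_j)$; 3. mutually orthogonal projections $P_{j,\lambda}$ $(\lambda\in\sigma(D_j))$ on $\mathcal H$ with $\sum_{\lambda}P_{j,\lambda}=I$ and $D_j=\sum_{\lambda}\lambda P_{j,\lambda}$, for $1\le j\le d$; 4. a doubly commuting tuple $(M_1,\dots,M_d)$ of invertible operators in $\mathcal C_{1,r}$ acting on $\mathcal K$, where $M_j$ is multiplication by $F_j$, that is, $(M_jf)(\zeta)=F_j(\zeta)f(\zeta)$ for all $f\in\mathcal K$ and almost every $\zeta\in\mathbb T$, with $$F_j(z)=\sum_{\lambda\in\sigma(D_j)}v\bigl(\varphi_{j,\lambda}(z)\bigr)\,U_jP_{j,\lambda},\qquad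 \varphi_{j,\lambda}(z)=\frac{w_{j,\lambda}-z}{1-\overline{w_{j,\lambda}}\,z},$$ such that $$T_1^{n_1}\cdots T_d^{n_d}=V^*M_1^{n_1}\cdots M_d^{n_d}V\qquad\text{for all integers } n_1,\dots,n_d.$$ -/

import Mathlib

open MeasureTheory

noncomputable section

namespace AnnulusDilation

section Operators

variable {H : Type*} [NormedAddCommGroup H] [InnerProductSpace ℂ H] [CompleteSpace H]

/-- The class `C_{1,r}`: invertible operators `T` (the type of units records invertibility)
with `‖T‖ ≤ 1` and `‖r T⁻¹‖ ≤ 1`. -/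
def MemC1r (r : ℝ) (T : (H →L[ℂ] H)ˣ) : Prop :=
  ‖(T : H →L[ℂ] H)‖ ≤ 1 ∧ ‖(r : ℂ) • ((T⁻¹ : (H →L[ℂ] H)ˣ) : H →L[ℂ] H)‖ ≤ 1

/-- The class `𝒞_{1,r}`: operators `J` for which there are orthogonal projections `P₀`, `P₁`
with `P₀ + P₁ = I` and `J* J = P₀ + r² P₁`. -/
def MemCalC1r (r : ℝ) (J : H →L[ℂ] H) : Prop :=
  ∃ P₀ P₁ : H →L[ℂ] H, IsStarProjection P₀ ∧ IsStarProjection P₁ ∧ P₀ + P₁ = 1 ∧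
    star J * J = P₀ + ((r : ℂ) ^ 2) • P₁

/-- A doubly commuting tuple: `T_i T_j = T_j T_i` and `T_i T_j* = T_j* T_i` for `i ≠ j`. -/
def DoublyCommuting {d : ℕ} (T : Fin d → (H →L[ℂ] H)) : Prop :=
  ∀ i j, i ≠ j → T i * T j = T j * T i ∧ T i * star (T j) = star (T j) * T i

/-- The ordered product `T_1^{n_1} ⋯ T_d^{n_d}` for an invertible tuple and integers `n_j`. -/
def intMonomial {d : ℕ} (T : Fin d → (H →L[ℂ] H)ˣ) (n : Fin d → ℤ) : H →L[ℂ] H :=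
  (((List.ofFn fun j => T j ^ n j).prod : (H →L[ℂ] H)ˣ) : H →L[ℂ] H)

/-- The isometry `V : H → K` dilates the tuple `T` on `H` to the tuple `J` on `K`:
`T_1^{n_1} ⋯ T_d^{n_d} = V* J_1^{n_1} ⋯ J_d^{n_d} V` for all integers `n_1, …, n_d`. -/
def IsDilation {K : Type*} [NormedAddCommGroup K] [InnerProductSpace ℂ K] [CompleteSpace K]
    {d : ℕ} (V : H →ₗᵢ[ℂ] K) (T : Fin d → (H →L[ℂ] H)ˣ) (J : Fin d → (K →L[ℂ] K)ˣ) : Prop :=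
  ∀ n : Fin d → ℤ, intMonomial T n =
    (ContinuousLinearMap.adjoint V.toContinuousLinearMap) ∘L (intMonomial J n) ∘L
      V.toContinuousLinearMap

/-- The positive operator `(T* T)^{1/2}`. -/
def absOp (T : H →L[ℂ] H) : H →L[ℂ] H := CFC.sqrt (star T * T)

/-- The polar factor `T ((T* T)^{1/2})⁻¹` of an invertible operator `T`
(for such `T`, `(T* T)^{1/2}` is invertible). -/
def polarFactor (T : H →L[ℂ] H) : H →L[ℂ] H := T * Ring.inverse (absOp T)

/-- `P` is the family of spectral projections of an operator `D` with finite spectrum `σ`: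
orthogonal projections `P_λ`, `λ ∈ σ`, which are mutually orthogonal, add up to the identity,
and satisfy `D = ∑ λ P_λ`. -/
structure IsSpectralFamily (D : H →L[ℂ] H) (σ : Finset ℂ) (P : ℂ → (H →L[ℂ] H)) : Prop where
  proj : ∀ l ∈ σ, IsStarProjection (P l)
  orthogonal : ∀ l ∈ σ, ∀ k ∈ σ, l ≠ k → P l * P k = 0
  sum_eq_one : ∑ l ∈ σ, P l = 1
  eq_sum : D = ∑ l ∈ σ, l • P l

end Operators

/-- The annulus `{z : r < |z| < 1}`. -/
def annulus (r : ℝ) : Set ℂ := {z | r < ‖z‖ ∧ ‖z‖ < 1}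

/-- An analytic map `v` of the open unit disk onto the annulus `{r < |z| < 1}`, with
`v(0) = √r`, which extends continuously to the closed disk without the points `±1` and sends
the open upper (lower) half of the unit circle onto the circle of radius `r` (of radius `1`). -/
structure IsDiskAnnulusMap (r : ℝ) (v : ℂ → ℂ) : Prop where
  analytic : AnalyticOnNhd ℂ v (Metric.ball 0 1)
  image_disk : v '' Metric.ball 0 1 = annulus r
  map_zero : v 0 = ((Real.sqrt r : ℝ) : ℂ)
  continuousOn : ContinuousOn v (Metric.closedBall 0 1 \ {1, -1})
  image_upper : v '' {z | ‖z‖ = 1 ∧ 0 < z.im} = Metric.sphere 0 r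
  image_lower : v '' {z | ‖z‖ = 1 ∧ z.im < 0} = Metric.sphere 0 1

/-- The involutive disk automorphism `z ↦ (w - z) / (1 - w̄ z)`, for `|w| < 1`. -/
def diskAut (w z : ℂ) : ℂ := (w - z) / (1 - star w * z)

/-- `L²(𝕋; H)`, the standard realization of the Hilbert space tensor product `L²(𝕋) ⊗ H`
(`f ⊗ h` is the function `ζ ↦ f(ζ) h`). The circle is parametrized by `t ↦ e^{2πit}`, `t` in
`ℝ / ℤ`, and carries the normalized arc length measure. -/
abbrev L2Circle (H : Type*) [NormedAddCommGroup H] : Type _ :=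
  Lp H 2 (AddCircle.haarAddCircle (T := (1 : ℝ)))

section Multiplication

variable {H : Type*} [NormedAddCommGroup H] [InnerProductSpace ℂ H] [CompleteSpace H]

/-- `M` is the operator of multiplication by the operator-valued function `F` on `L²(𝕋; H)`:
`(M f)(ζ) = F(ζ) f(ζ)` for almost every `ζ` in the circle. -/
def IsMultiplicationBy (M : L2Circle H →L[ℂ] L2Circle H) (F : ℂ → (H →L[ℂ] H)) : Prop :=
  ∀ f : L2Circle H, ∀ᵐ t ∂(AddCircle.haarAddCircle (T := (1 : ℝ))),
    M f t = F (AddCircle.toCircle t : ℂ) (f t)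

/-- The operator-valued function
`F(z) = ∑_{λ ∈ σ} v(φ_λ(z)) U P_λ`, where `φ_λ` is the disk automorphism with parameter `w_λ`
and `U` is the polar factor of `T`. -/
def symbol (T : H →L[ℂ] H) (σ : Finset ℂ) (P : ℂ → (H →L[ℂ] H)) (v w : ℂ → ℂ) (z : ℂ) :
    H →L[ℂ] H :=
  ∑ l ∈ σ, v (diskAut (w l) z) • (polarFactor T * P l)

end Multiplication

end AnnulusDilation

end

/-!
The map `v` is the universal covering of the annulus: the Cayley transform takes the disk to the
right half-plane, the logarithm takes that to a strip, and an affine map followed by `exp` wraps the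
strip around the annulus (`annulusCover`, `isDiskAnnulusMap_annulusCover`). It never vanishes, and
on the circle without `±1` its modulus is `r` or `1`.

With the spectral projections `P_{j,λ}` of `D_j = (T_j* T_j)^{1/2}` and points `w_{j,λ}` over `λ`,
the symbol is `F_j(z) = U_j ∑ v(φ_{j,λ}(z)) P_{j,λ}`, where `U_j` is unitary. So `F_j` is bounded,
analytic and invertible in the disk, with bounded inverse, and `F_j(0) = U_j D_j = T_j`. On the
circle `F_j* F_j = ∑ |v ∘ φ_{j,λ}|² P_{j,λ}` has coefficients in `{1, r²}`, as `𝒞_{1,r}` requires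
(`memCalC1r_of_mulBy`).

The dilation property is the mean value property. A monomial in the `F_j` and their inverses is
again bounded and analytic, and its compression to the constant functions is the mean of its
boundary values (`MulBy.compression_eq_integral`), that is, its value at `0`
(`IsBddAnalytic.integral_eq`), which is the same monomial in the `T_j`. As `v` is discontinuous at
`±1`, the boundary values are only radial limits almost everywhere, and the mean value property
follows from that on smaller circles by dominated convergence. All the symbols with these
properties, paired with their multiplication operators, form a group (`analyticMultiplierGroup`),
so integer monomials need no separate treatment. Finally `F_i(z)` is built from `T_i`, `T_i*` by
operations which preserve commutants, so double commutation passes to the symbols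
(`commute_symbol_cfc`) and from there to the multiplication operators.
-/

open MeasureTheory

noncomputable section

namespace AnnulusDilation

open Complex Filter Topology

/-! ### The universal covering of the annulus -/

/-- The Cayley transform, a conformal map of the unit disk onto the right half-plane. -/
def cayley (z : ℂ) : ℂ := (1 + z) / (1 - z)

lemma cayley_re (z : ℂ) : (cayley z).re = (1 - ‖z‖ ^ 2) / normSq (1 - z) := by
  rw [cayley, div_re, ← add_div, Complex.sq_norm]
  congr 1
  simp [normSq_apply]
  ring

lemma cayley_im (z : ℂ) : (cayley z).im = 2 * z.im / normSq (1 - z) := by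
  rw [cayley, div_im, ← sub_div]
  congr 1
  simp
  ring

lemma normSq_one_sub_pos {z : ℂ} (hz : z ≠ 1) : 0 < normSq (1 - z) :=
  normSq_pos.2 (sub_ne_zero.2 hz.symm)

lemma cayley_re_nonneg {z : ℂ} (hz : ‖z‖ ≤ 1) : 0 ≤ (cayley z).re := by
  rw [cayley_re]
  have : ‖z‖ ^ 2 ≤ 1 := pow_le_one₀ (norm_nonneg z) hz
  exact div_nonneg (by linarith) (normSq_nonneg _)

lemma cayley_re_pos_iff {z : ℂ} (hz : z ≠ 1) : 0 < (cayley z).re ↔ ‖z‖ < 1 := by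
  rw [cayley_re, div_pos_iff_of_pos_right (normSq_one_sub_pos hz), sub_pos,
    sq_lt_one_iff₀ (norm_nonneg z)]

lemma cayley_re_eq_zero_iff {z : ℂ} (hz : z ≠ 1) : (cayley z).re = 0 ↔ ‖z‖ = 1 := by
  rw [cayley_re, div_eq_zero_iff, or_iff_left (normSq_one_sub_pos hz).ne', sub_eq_zero, eq_comm,
    pow_eq_one_iff_of_nonneg (norm_nonneg z) two_ne_zero]

lemma cayley_im_pos_iff {z : ℂ} (hz : z ≠ 1) : 0 < (cayley z).im ↔ 0 < z.im := by
  rw [cayley_im, div_pos_iff_of_pos_right (normSq_one_sub_pos hz)]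
  constructor <;> intro h <;> linarith

lemma cayley_im_neg_iff {z : ℂ} (hz : z ≠ 1) : (cayley z).im < 0 ↔ z.im < 0 := by
  rw [cayley_im, div_lt_iff₀ (normSq_one_sub_pos hz), zero_mul]
  constructor <;> intro h <;> linarith

lemma cayley_mem_slitPlane {z : ℂ} (hz : ‖z‖ ≤ 1) (h1 : z ≠ 1) (h2 : z ≠ -1) :
    cayley z ∈ slitPlane := by
  by_contra h
  rw [mem_slitPlane_iff, not_or, not_not, not_lt] at h
  have h0 : cayley z = 0 := Complex.ext (le_antisymm h.1 (cayley_re_nonneg hz)) h.2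
  rw [cayley, div_eq_zero_iff] at h0
  rcases h0 with h0 | h0
  · exact h2 (by linear_combination h0)
  · exact h1 (by linear_combination -h0)

lemma exists_cayley_eq {E : ℂ} (hE : E ≠ -1) : ∃ z, z ≠ 1 ∧ cayley z = E := by
  have h : E + 1 ≠ 0 := fun h => hE (by linear_combination h)
  refine ⟨(E - 1) / (E + 1), ?_, ?_⟩
  · rw [Ne, div_eq_one_iff_eq h]
    intro h'
    have : (2 : ℂ) = 0 := by linear_combination -h'
    norm_num at this
  · have h1 : 1 - (E - 1) / (E + 1) = 2 / (E + 1) := by field_simp; ring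
    have h2 : 1 + (E - 1) / (E + 1) = 2 * E / (E + 1) := by field_simp; ring
    rw [cayley, h1, h2]
    field_simp

/-- The covering map of the unit disk onto the annulus `{r < |z| < 1}`: the principal logarithm
takes the right half-plane to the strip `|Im s| < π / 2`, which an affine map followed by the
exponential wraps around the annulus. At `±1` the value is `√r`, by the conventions for division
by zero and for the logarithm of zero. -/
def annulusCover (r : ℝ) (z : ℂ) : ℂ :=
  exp (Real.log r / 2 - I * (Real.log r / Real.pi) * log (cayley z))

lemma annulusCover_ne_zero (r : ℝ) (z : ℂ) : annulusCover r z ≠ 0 := exp_ne_zero _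

lemma norm_annulusCover (r : ℝ) (z : ℂ) :
    ‖annulusCover r z‖ = Real.exp (Real.log r * (1 / 2 + (cayley z).arg / Real.pi)) := by
  rw [annulusCover, norm_exp]
  congr 1
  rw [sub_re, mul_re, ← ofReal_div]
  simp [log_im]
  ring

lemma norm_annulusCover_mem {r : ℝ} (hr₀ : 0 < r) (hr₁ : r < 1) {z : ℂ} (hz : ‖z‖ ≤ 1) :
    r ≤ ‖annulusCover r z‖ ∧ ‖annulusCover r z‖ ≤ 1 := by
  have ha := abs_le.1 (abs_arg_le_pi_div_two_iff.2 (cayley_re_nonneg hz))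
  have hl := Real.log_neg hr₀ hr₁
  have h1 : (cayley z).arg / Real.pi ≤ 1 / 2 := by
    rw [div_le_iff₀ Real.pi_pos]; linarith [ha.2]
  have h2 : -(1 / 2) ≤ (cayley z).arg / Real.pi := by
    rw [le_div_iff₀ Real.pi_pos]; linarith [ha.1]
  rw [norm_annulusCover]
  constructor
  · rw [← Real.log_le_iff_le_exp hr₀]
    nlinarith
  · rw [Real.exp_le_one_iff]
    nlinarith

lemma norm_annulusCover_of_norm_lt {r : ℝ} (hr₀ : 0 < r) (hr₁ : r < 1) {z : ℂ} (hz : ‖z‖ < 1) :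
    r < ‖annulusCover r z‖ ∧ ‖annulusCover r z‖ < 1 := by
  have h1 : z ≠ 1 := by rintro rfl; simp at hz
  have ha := abs_lt.1 (abs_arg_lt_pi_div_two_iff.2 (Or.inl ((cayley_re_pos_iff h1).2 hz)))
  have hl := Real.log_neg hr₀ hr₁
  have h1 : (cayley z).arg / Real.pi < 1 / 2 := by
    rw [div_lt_iff₀ Real.pi_pos]; linarith [ha.2]
  have h2 : -(1 / 2) < (cayley z).arg / Real.pi := by
    rw [lt_div_iff₀ Real.pi_pos]; linarith [ha.1]
  rw [norm_annulusCover]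
  constructor
  · rw [← Real.log_lt_iff_lt_exp hr₀]
    nlinarith
  · rw [Real.exp_lt_one_iff]
    nlinarith

lemma norm_annulusCover_of_im_pos {r : ℝ} (hr₀ : 0 < r) {z : ℂ} (hz : ‖z‖ = 1) (him : 0 < z.im) :
    ‖annulusCover r z‖ = r := by
  have h1 : z ≠ 1 := by rintro rfl; simp at him
  have ha : (cayley z).arg = Real.pi / 2 :=
    arg_eq_pi_div_two_iff.2 ⟨(cayley_re_eq_zero_iff h1).2 hz, (cayley_im_pos_iff h1).2 him⟩
  rw [norm_annulusCover, ha]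
  convert Real.exp_log hr₀ using 2
  field_simp
  ring

lemma norm_annulusCover_of_im_neg (r : ℝ) {z : ℂ} (hz : ‖z‖ = 1) (him : z.im < 0) :
    ‖annulusCover r z‖ = 1 := by
  have h1 : z ≠ 1 := by rintro rfl; simp at him
  have ha : (cayley z).arg = -(Real.pi / 2) :=
    arg_eq_neg_pi_div_two_iff.2 ⟨(cayley_re_eq_zero_iff h1).2 hz, (cayley_im_neg_iff h1).2 him⟩
  rw [norm_annulusCover, ha, Real.exp_eq_one_iff]
  field_simp
  ring

lemma norm_annulusCover_of_norm_eq_one {r : ℝ} (hr₀ : 0 < r) {z : ℂ} (hz : ‖z‖ = 1)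
    (h1 : z ≠ 1) (h2 : z ≠ -1) : ‖annulusCover r z‖ = r ∨ ‖annulusCover r z‖ = 1 := by
  rcases lt_trichotomy z.im 0 with h | h | h
  · exact Or.inr (norm_annulusCover_of_im_neg r hz h)
  · have hre : z.re ^ 2 = 1 := by
      have := Complex.sq_norm z
      rw [normSq_apply, h, hz] at this
      linarith
    rcases mul_self_eq_one_iff.1 ((sq z.re).symm.trans hre) with hre | hre
    · exact absurd (Complex.ext hre (by simpa using h)) h1
    · exact absurd (Complex.ext (by simpa using hre) (by simpa using h)) h2
  · exact Or.inl (norm_annulusCover_of_im_pos hr₀ hz h)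

/-- Every point of the closed annulus is a value of the covering map, at a point whose Cayley
transform is nonzero and has the argument that the modulus dictates. -/
lemma exists_annulusCover_eq {r : ℝ} (hr₀ : 0 < r) (hr₁ : r < 1) {u : ℂ} (hu : r ≤ ‖u‖)
    (hu' : ‖u‖ ≤ 1) : ∃ z, z ≠ 1 ∧ cayley z ≠ 0 ∧ annulusCover r z = u ∧
      (cayley z).arg = Real.pi * (Real.log ‖u‖ / Real.log r - 1 / 2) := by
  have hl := Real.log_neg hr₀ hr₁
  have hu0 : 0 < ‖u‖ := hr₀.trans_le hu
  have hlog : Real.log r ≤ Real.log ‖u‖ := Real.log_le_log hr₀ hu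
  have hlog' : Real.log ‖u‖ ≤ 0 := Real.log_nonpos hu0.le hu'
  have hq0 : 0 ≤ Real.log ‖u‖ / Real.log r := div_nonneg_of_nonpos hlog' hl.le
  have hq1 : Real.log ‖u‖ / Real.log r ≤ 1 := by rwa [div_le_one_of_neg hl]
  have hpi := Real.pi_pos
  -- `s` solves `log r / 2 - i (log r / π) s = log u`
  set s : ℂ := I * ((Real.pi / Real.log r : ℝ) : ℂ) * (log u - (Real.log r / 2 : ℝ)) with hs
  have him : s.im = Real.pi * (Real.log ‖u‖ / Real.log r - 1 / 2) := by
    simp only [hs, mul_im, mul_re, I_re, I_im, ofReal_re, ofReal_im, sub_re, sub_im, log_re]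
    field_simp [hl.ne]
    ring
  have h1 : -Real.pi < s.im := by rw [him]; nlinarith
  have h2 : s.im < Real.pi := by rw [him]; nlinarith
  have hlogexp : log (exp s) = s := log_exp h1 h2.le
  have hE : exp s ≠ -1 := by
    intro h
    rw [h, log_neg_one] at hlogexp
    rw [← hlogexp] at h2
    simp at h2
  obtain ⟨z, hz1, hz⟩ := exists_cayley_eq hE
  refine ⟨z, hz1, hz ▸ exp_ne_zero s, ?_, ?_⟩
  · rw [annulusCover, hz, hlogexp, hs]
    convert exp_log (norm_pos_iff.1 hu0) using 2
    have hl' : (Real.log r : ℂ) ≠ 0 := by exact_mod_cast hl.ne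
    have hpi' : (Real.pi : ℂ) ≠ 0 := by exact_mod_cast hpi.ne'
    push_cast
    field_simp
    linear_combination (-2 * log u + Real.log r) * I_sq
  · rw [hz, ← log_im, hlogexp, him]

lemma continuousOn_annulusCover (r : ℝ) :
    ContinuousOn (annulusCover r) (Metric.closedBall 0 1 \ {1, -1}) := by
  intro z hz
  simp only [Set.mem_sdiff, Metric.mem_closedBall, dist_zero_right, Set.mem_insert_iff,
    Set.mem_singleton_iff, not_or] at hz
  have hc : ContinuousAt cayley z := by
    have : 1 - z ≠ 0 := sub_ne_zero.2 (Ne.symm hz.2.1)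
    unfold cayley
    fun_prop (disch := assumption)
  have hl : ContinuousAt (fun z => log (cayley z)) z :=
    hc.clog (cayley_mem_slitPlane hz.1 hz.2.1 hz.2.2)
  unfold annulusCover
  exact ContinuousAt.continuousWithinAt (by fun_prop)

lemma differentiableOn_annulusCover (r : ℝ) :
    DifferentiableOn ℂ (annulusCover r) (Metric.ball 0 1) := by
  intro z hz
  rw [Metric.mem_ball, dist_zero_right] at hz
  have h1 : z ≠ 1 := by rintro rfl; simp at hz
  have h2 : z ≠ -1 := by rintro rfl; simp at hz
  have hc : DifferentiableAt ℂ cayley z := by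
    have : 1 - z ≠ 0 := sub_ne_zero.2 h1.symm
    unfold cayley
    fun_prop (disch := assumption)
  have hl : DifferentiableAt ℂ (fun z => log (cayley z)) z :=
    hc.clog (cayley_mem_slitPlane hz.le h1 h2)
  unfold annulusCover
  exact DifferentiableAt.differentiableWithinAt (by fun_prop)

lemma isDiskAnnulusMap_annulusCover {r : ℝ} (hr₀ : 0 < r) (hr₁ : r < 1) :
    IsDiskAnnulusMap r (annulusCover r) := by
  have hl := Real.log_neg hr₀ hr₁
  have hpi := Real.pi_pos
  refine ⟨(differentiableOn_annulusCover r).analyticOnNhd Metric.isOpen_ball, ?_, ?_,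
    continuousOn_annulusCover r, ?_, ?_⟩
  · ext u
    constructor
    · rintro ⟨z, hz, rfl⟩
      exact norm_annulusCover_of_norm_lt hr₀ hr₁ (by simpa using hz)
    · rintro ⟨hu, hu'⟩
      obtain ⟨z, hz1, hc, rfl, hz⟩ := exists_annulusCover_eq hr₀ hr₁ hu.le hu'.le
      refine ⟨z, ?_, rfl⟩
      have hq0 : 0 < Real.log ‖annulusCover r z‖ / Real.log r :=
        div_pos_of_neg_of_neg (Real.log_neg (hr₀.trans hu) hu') hl
      have hq1 : Real.log ‖annulusCover r z‖ / Real.log r < 1 := by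
        rw [div_lt_one_of_neg hl]; exact Real.log_lt_log hr₀ hu
      have : |(cayley z).arg| < Real.pi / 2 := by
        rw [hz, abs_lt]; constructor <;> nlinarith
      rcases abs_arg_lt_pi_div_two_iff.1 this with h | h
      · simpa using (cayley_re_pos_iff hz1).1 h
      · exact absurd h hc
  · rw [annulusCover]
    simp only [cayley, add_zero, sub_zero, div_one, log_one, mul_zero]
    rw [Real.sqrt_eq_rpow, Real.rpow_def_of_pos hr₀]
    push_cast
    congr 1
    ring
  · ext u
    simp only [Set.mem_image, Set.mem_ofPred_eq, mem_sphere_iff_norm, sub_zero]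
    constructor
    · rintro ⟨z, ⟨hz, him⟩, rfl⟩
      exact norm_annulusCover_of_im_pos hr₀ hz him
    · intro hu
      obtain ⟨z, hz1, -, hzu, hz⟩ := exists_annulusCover_eq hr₀ hr₁ hu.ge (hu.trans_le hr₁.le)
      have : (cayley z).arg = Real.pi / 2 := by
        rw [hz, hu, div_self hl.ne]; ring
      obtain ⟨h1, h2⟩ := arg_eq_pi_div_two_iff.1 this
      exact ⟨z, ⟨(cayley_re_eq_zero_iff hz1).1 h1, (cayley_im_pos_iff hz1).1 h2⟩, hzu⟩
  · ext u
    simp only [Set.mem_image, Set.mem_ofPred_eq, mem_sphere_iff_norm, sub_zero]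
    constructor
    · rintro ⟨z, ⟨hz, him⟩, rfl⟩
      exact norm_annulusCover_of_im_neg r hz him
    · intro hu
      obtain ⟨z, hz1, -, hzu, hz⟩ := exists_annulusCover_eq hr₀ hr₁ (hr₁.le.trans hu.ge) hu.le
      have : (cayley z).arg = -(Real.pi / 2) := by
        rw [hz, hu, Real.log_one]; ring
      obtain ⟨h1, h2⟩ := arg_eq_neg_pi_div_two_iff.1 this
      exact ⟨z, ⟨(cayley_re_eq_zero_iff hz1).1 h1, (cayley_im_neg_iff hz1).1 h2⟩, hzu⟩

lemma measurable_annulusCover (r : ℝ) : Measurable (annulusCover r) := by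
  unfold annulusCover cayley
  fun_prop

/-! ### Disk automorphisms -/

lemma normSq_diskAut (w z : ℂ) :
    normSq (1 - star w * z) - normSq (w - z) = (1 - ‖w‖ ^ 2) * (1 - ‖z‖ ^ 2) := by
  rw [Complex.sq_norm, Complex.sq_norm]
  simp [normSq_apply]
  ring

lemma one_sub_star_mul_ne_zero {w z : ℂ} (hw : ‖w‖ < 1) (hz : ‖z‖ ≤ 1) : 1 - star w * z ≠ 0 := by
  intro h
  have : ‖star w * z‖ = 1 := by rw [← sub_eq_zero.1 h, norm_one]
  rw [norm_mul, norm_star] at this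
  nlinarith [norm_nonneg w, norm_nonneg z]

lemma sq_norm_diskAut {w z : ℂ} (hw : ‖w‖ < 1) (hz : ‖z‖ ≤ 1) :
    ‖diskAut w z‖ ^ 2 = 1 - (1 - ‖w‖ ^ 2) * (1 - ‖z‖ ^ 2) / normSq (1 - star w * z) := by
  have h := normSq_pos.2 (one_sub_star_mul_ne_zero hw hz)
  rw [diskAut, norm_div, div_pow, Complex.sq_norm, Complex.sq_norm, ← normSq_diskAut,
    sub_div, div_self h.ne', sub_sub_cancel]

lemma one_sub_sq_norm_pos {w : ℂ} (hw : ‖w‖ < 1) : 0 < 1 - ‖w‖ ^ 2 :=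
  sub_pos.2 ((sq_lt_one_iff₀ (norm_nonneg w)).2 hw)

lemma norm_diskAut_lt_one {w z : ℂ} (hw : ‖w‖ < 1) (hz : ‖z‖ < 1) : ‖diskAut w z‖ < 1 := by
  rw [← sq_lt_one_iff₀ (norm_nonneg _), sq_norm_diskAut hw hz.le]
  have := div_pos (mul_pos (one_sub_sq_norm_pos hw) (one_sub_sq_norm_pos hz))
    (normSq_pos.2 (one_sub_star_mul_ne_zero hw hz.le))
  linarith

lemma norm_diskAut_eq_one {w z : ℂ} (hw : ‖w‖ < 1) (hz : ‖z‖ = 1) : ‖diskAut w z‖ = 1 := by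
  rw [← pow_eq_one_iff_of_nonneg (norm_nonneg _) two_ne_zero,
    sq_norm_diskAut hw hz.le, hz]
  simp

lemma norm_diskAut_le_one {w z : ℂ} (hw : ‖w‖ < 1) (hz : ‖z‖ ≤ 1) : ‖diskAut w z‖ ≤ 1 :=
  hz.lt_or_eq.elim (fun h => (norm_diskAut_lt_one hw h).le) fun h => (norm_diskAut_eq_one hw h).le

lemma differentiableAt_diskAut {w z : ℂ} (hw : ‖w‖ < 1) (hz : ‖z‖ ≤ 1) :
    DifferentiableAt ℂ (diskAut w) z := by
  have := one_sub_star_mul_ne_zero hw hz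
  unfold diskAut
  fun_prop (disch := assumption)

lemma diskAut_zero_right (w : ℂ) : diskAut w 0 = w := by simp [diskAut]

lemma diskAut_injOn {w : ℂ} (hw : ‖w‖ < 1) : Set.InjOn (diskAut w) (Metric.closedBall 0 1) := by
  intro x hx y hy h
  rw [mem_closedBall_zero_iff] at hx hy
  rw [diskAut, diskAut, div_eq_div_iff (one_sub_star_mul_ne_zero hw hx)
    (one_sub_star_mul_ne_zero hw hy)] at h
  have hw' : (1 - star w * w) ≠ 0 := one_sub_star_mul_ne_zero hw hw.le
  exact mul_left_cancel₀ hw' (by linear_combination -h)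

lemma measurable_diskAut (w : ℂ) : Measurable (diskAut w) := by
  unfold diskAut
  fun_prop

/-! ### Bounded analytic functions with radial boundary values -/

section BoundedAnalytic

variable {E : Type*} [NormedAddCommGroup E] [NormedSpace ℂ E]

/-- A vector-valued function on the closed disk which is analytic on the open disk, bounded, and
whose values at almost every point of the circle are its radial limits. -/
structure IsBddAnalytic (f : ℂ → E) : Prop where
  differentiableOn : DifferentiableOn ℂ f (Metric.ball 0 1)
  bounded : ∃ C, ∀ z ∈ Metric.closedBall (0 : ℂ) 1, ‖f z‖ ≤ C
  radial : ∀ᵐ t ∂(AddCircle.haarAddCircle (T := (1 : ℝ))),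
    Tendsto (fun ρ : ℝ => f (ρ * (AddCircle.toCircle t : ℂ))) (𝓝[<] 1)
      (𝓝 (f (AddCircle.toCircle t)))

namespace IsBddAnalytic

lemma const (a : E) : IsBddAnalytic fun _ => a :=
  ⟨differentiableOn_const a, ⟨‖a‖, fun _ _ => le_rfl⟩, .of_forall fun _ => tendsto_const_nhds⟩

lemma add {f g : ℂ → E} (hf : IsBddAnalytic f) (hg : IsBddAnalytic g) :
    IsBddAnalytic fun z => f z + g z := by
  obtain ⟨C, hC⟩ := hf.bounded
  obtain ⟨D, hD⟩ := hg.bounded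
  refine ⟨hf.1.add hg.1, ⟨C + D, fun z hz => norm_add_le_of_le (hC z hz) (hD z hz)⟩, ?_⟩
  filter_upwards [hf.radial, hg.radial] with t h1 h2 using h1.add h2

lemma sum {ι : Type*} {s : Finset ι} {f : ι → ℂ → E} (hf : ∀ i ∈ s, IsBddAnalytic (f i)) :
    IsBddAnalytic fun z => ∑ i ∈ s, f i z := by
  classical
  induction s using Finset.induction_on with
  | empty => simpa using const (0 : E)
  | insert i s hi ih =>
    simp only [Finset.sum_insert hi]
    exact (hf i (by simp)).add (ih fun j hj => hf j (by simp [hj]))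

lemma smul_const {f : ℂ → ℂ} (hf : IsBddAnalytic f) (a : E) :
    IsBddAnalytic fun z => f z • a := by
  obtain ⟨C, hC⟩ := hf.bounded
  refine ⟨hf.1.smul_const a, ⟨C * ‖a‖, fun z hz => ?_⟩, ?_⟩
  · rw [norm_smul]
    exact mul_le_mul_of_nonneg_right (hC z hz) (norm_nonneg a)
  · filter_upwards [hf.radial] with t h using h.smul_const a

lemma mul {A : Type*} [NormedRing A] [NormedAlgebra ℂ A] {f g : ℂ → A} (hf : IsBddAnalytic f)
    (hg : IsBddAnalytic g) : IsBddAnalytic fun z => f z * g z := by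
  obtain ⟨C, hC⟩ := hf.bounded
  obtain ⟨D, hD⟩ := hg.bounded
  refine ⟨hf.1.mul hg.1, ⟨C * D, fun z hz => ?_⟩, ?_⟩
  · exact (norm_mul_le _ _).trans (mul_le_mul (hC z hz) (hD z hz) (norm_nonneg _)
      ((norm_nonneg _).trans (hC z hz)))
  · filter_upwards [hf.radial, hg.radial] with t h1 h2 using h1.mul h2

/-- The mean value property on the circle of radius `ρ < 1`, in terms of the parameter `t`. -/
lemma integral_dilate [CompleteSpace E] {f : ℂ → E} (hf : IsBddAnalytic f) {ρ : ℝ} (h0 : 0 < ρ)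
    (h1 : ρ < 1) : ∫ t, f (ρ * (AddCircle.toCircle t : ℂ))
      ∂(AddCircle.haarAddCircle (T := (1 : ℝ))) = f 0 := by
  have hsub : Metric.closedBall (0 : ℂ) ρ ⊆ Metric.ball 0 1 := Metric.closedBall_subset_ball h1
  have hd : DiffContOnCl ℂ f (Metric.ball 0 |ρ|) := by
    rw [abs_of_pos h0]
    exact (hf.1.mono (by rwa [closure_ball _ h0.ne'])).diffContOnCl
  have := hd.circleAverage
  rw [← this, AddCircle.integral_haarAddCircle, Real.circleAverage_def,
    ← AddCircle.intervalIntegral_preimage 1 0]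
  simp only [AddCircle.toCircle_apply_mk, Circle.coe_exp, circleMap]
  have h := intervalIntegral.integral_comp_mul_left (a := 0) (b := 1)
    (fun θ : ℝ => f (ρ * exp (θ * I))) (c := 2 * Real.pi) (by positivity)
  simp only [mul_zero, mul_one] at h
  simp only [zero_add, inv_one, one_smul, div_one, ← h]

lemma continuous_dilate {f : ℂ → E} (hf : IsBddAnalytic f) {ρ : ℝ} (h0 : 0 < ρ) (h1 : ρ < 1) :
    Continuous fun t : AddCircle (1 : ℝ) => f (ρ * (AddCircle.toCircle t : ℂ)) := by
  refine hf.1.continuousOn.comp_continuous ?_ fun t => ?_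
  · exact continuous_const.mul (continuous_subtype_val.comp AddCircle.continuous_toCircle)
  · simpa [Circle.norm_coe, abs_of_pos h0] using h1

lemma eventually_mem_Ioo : ∀ᶠ ρ : ℝ in 𝓝[<] 1, 0 < ρ ∧ ρ < 1 :=
  Ioo_mem_nhdsLT one_pos

lemma aestronglyMeasurable {f : ℂ → E} (hf : IsBddAnalytic f) :
    AEStronglyMeasurable (fun t => f (AddCircle.toCircle t : ℂ))
      (AddCircle.haarAddCircle (T := (1 : ℝ))) := by
  obtain ⟨u, -, hu, hlim⟩ := exists_seq_strictMono_tendsto' (zero_lt_one' ℝ)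
  have hlim' : Tendsto u atTop (𝓝[<] 1) :=
    tendsto_nhdsWithin_iff.2 ⟨hlim, .of_forall fun n => (hu n).2⟩
  refine aestronglyMeasurable_of_tendsto_ae atTop
    (f := fun n t => f (u n * (AddCircle.toCircle t : ℂ)))
    (fun n => (hf.continuous_dilate (hu n).1 (hu n).2).aestronglyMeasurable) ?_
  filter_upwards [hf.radial] with t ht using ht.comp hlim'

/-- The mean value property, in terms of boundary values. -/
lemma integral_eq [CompleteSpace E] {f : ℂ → E} (hf : IsBddAnalytic f) :
    ∫ t, f (AddCircle.toCircle t : ℂ) ∂(AddCircle.haarAddCircle (T := (1 : ℝ))) = f 0 := by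
  obtain ⟨C, hC⟩ := hf.bounded
  have key : Tendsto (fun ρ : ℝ => ∫ t, f (ρ * (AddCircle.toCircle t : ℂ))
      ∂(AddCircle.haarAddCircle (T := (1 : ℝ)))) (𝓝[<] 1)
      (𝓝 (∫ t, f (AddCircle.toCircle t : ℂ) ∂(AddCircle.haarAddCircle (T := (1 : ℝ))))) := by
    refine tendsto_integral_filter_of_dominated_convergence (fun _ => C) ?_ ?_
      (integrable_const C) hf.radial
    · filter_upwards [eventually_mem_Ioo] with ρ hρ
      exact (hf.continuous_dilate hρ.1 hρ.2).aestronglyMeasurable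
    · filter_upwards [eventually_mem_Ioo] with ρ hρ
      refine .of_forall fun t => hC _ ?_
      simpa [Circle.norm_coe, abs_of_pos hρ.1] using hρ.2.le
  refine tendsto_nhds_unique key (tendsto_const_nhds.congr' ?_)
  filter_upwards [eventually_mem_Ioo] with ρ hρ using (hf.integral_dilate hρ.1 hρ.2).symm

end IsBddAnalytic

instance : Nontrivial (AddCircle (1 : ℝ)) := by
  by_contra h
  rw [not_nontrivial_iff_subsingleton] at h
  have h2 := AddCircle.addOrderOf_period_div (p := (1 : ℝ)) two_pos
  rw [Subsingleton.elim ((((1 : ℝ) / (2 : ℕ) : ℝ)) : AddCircle (1 : ℝ)) 0, addOrderOf_zero] at h2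
  norm_num at h2

lemma ae_toCircle_ne (z : ℂ) :
    ∀ᵐ t ∂(AddCircle.haarAddCircle (T := (1 : ℝ))), (AddCircle.toCircle t : ℂ) ≠ z := by
  have : (𝓝[≠] (0 : AddCircle (1 : ℝ))).NeBot :=
    ConnectedSpace.neBot_nhdsWithin_compl_of_nontrivial_of_t1space 0
  have : {t : AddCircle (1 : ℝ) | (AddCircle.toCircle t : ℂ) = z}.Subsingleton :=
    fun x hx y hy => AddCircle.injective_toCircle one_ne_zero (Subtype.ext (hx.trans hy.symm))
  exact measure_mono_null (fun t ht => not_not.1 ht) (this.measure_zero _)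

lemma ae_diskAut_toCircle_ne {w : ℂ} (hw : ‖w‖ < 1) (z : ℂ) :
    ∀ᵐ t ∂(AddCircle.haarAddCircle (T := (1 : ℝ))), diskAut w (AddCircle.toCircle t) ≠ z := by
  by_cases h : ∃ x : Circle, diskAut w x = z
  · obtain ⟨x, rfl⟩ := h
    filter_upwards [ae_toCircle_ne x] with t ht h
    exact ht (diskAut_injOn hw (by simp [Circle.norm_coe]) (by simp [Circle.norm_coe]) h)
  · exact .of_forall fun t ht => h ⟨_, ht⟩

lemma isBddAnalytic_comp_diskAut {f : ℂ → ℂ} (hf : DifferentiableOn ℂ f (Metric.ball 0 1))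
    (hfc : ContinuousOn f (Metric.closedBall 0 1 \ {1, -1})) {C : ℝ}
    (hC : ∀ z : ℂ, ‖z‖ ≤ 1 → ‖f z‖ ≤ C) {w : ℂ} (hw : ‖w‖ < 1) :
    IsBddAnalytic fun z => f (diskAut w z) := by
  refine ⟨?_, ⟨C, fun z hz => hC _ (norm_diskAut_le_one hw (by simpa using hz))⟩, ?_⟩
  · refine hf.comp (t := Metric.ball 0 1) (fun z hz => ?_) fun z hz => ?_
    · exact (differentiableAt_diskAut hw
        (by simpa using (Metric.ball_subset_closedBall hz))).differentiableWithinAt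
    · simpa using norm_diskAut_lt_one hw (by simpa using hz)
  · filter_upwards [ae_diskAut_toCircle_ne hw 1, ae_diskAut_toCircle_ne hw (-1)] with t h1 h2
    have hnorm : ‖(AddCircle.toCircle t : ℂ)‖ = 1 := Circle.norm_coe _
    have hn := norm_diskAut_eq_one hw hnorm
    have hc : ContinuousWithinAt f (Metric.closedBall 0 1 \ {1, -1})
        (diskAut w (AddCircle.toCircle t)) := hfc _ (by simp [hn, h1, h2])
    have hρ : Tendsto (fun ρ : ℝ => (ρ * (AddCircle.toCircle t : ℂ))) (𝓝[<] 1)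
        (𝓝 (AddCircle.toCircle t : ℂ)) := by
      have : Continuous fun ρ : ℝ => (ρ * (AddCircle.toCircle t : ℂ)) := by fun_prop
      simpa using (this.tendsto 1).mono_left nhdsWithin_le_nhds
    refine hc.tendsto.comp (tendsto_nhdsWithin_iff.2
      ⟨(differentiableAt_diskAut hw hnorm.le).continuousAt.tendsto.comp hρ, ?_⟩)
    filter_upwards [IsBddAnalytic.eventually_mem_Ioo] with ρ hρ
    have hlt : ‖(ρ * (AddCircle.toCircle t : ℂ))‖ < 1 := by
      simpa [Circle.norm_coe, abs_of_pos hρ.1] using hρ.2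
    have hlt' := norm_diskAut_lt_one hw hlt
    refine ⟨by simpa using hlt'.le, ?_⟩
    rintro (h | h)
    · rw [h] at hlt'; simp at hlt'
    · rw [Set.mem_singleton_iff.1 h] at hlt'; simp at hlt'

end BoundedAnalytic

/-! ### Multiplication operators on the circle -/

section MultiplicationOperators

variable {H : Type*} [NormedAddCommGroup H] [InnerProductSpace ℂ H]

/-- `M` is multiplication by the operator-valued function `F`, here a function of the parameter
`t` of the circle. -/
def MulBy (M : L2Circle H →L[ℂ] L2Circle H) (F : AddCircle (1 : ℝ) → H →L[ℂ] H) : Prop :=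
  ∀ f : L2Circle H, ∀ᵐ t ∂(AddCircle.haarAddCircle (T := (1 : ℝ))), M f t = F t (f t)

lemma exists_mulBy {F : AddCircle (1 : ℝ) → H →L[ℂ] H}
    (hF : AEStronglyMeasurable F (AddCircle.haarAddCircle (T := (1 : ℝ)))) {C : ℝ}
    (hC : ∀ t, ‖F t‖ ≤ C) : ∃ M : L2Circle H →L[ℂ] L2Circle H, MulBy M F := by
  have hmem : MemLp F ⊤ (AddCircle.haarAddCircle (T := (1 : ℝ))) :=
    memLp_top_of_bound hF C (.of_forall hC)
  refine ⟨(ContinuousLinearMap.id ℂ (H →L[ℂ] H)).holderL AddCircle.haarAddCircle ⊤ 2 2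
    hmem.toLp, fun f => ?_⟩
  filter_upwards [(ContinuousLinearMap.id ℂ (H →L[ℂ] H)).coeFn_holder (r := 2) hmem.toLp f,
    hmem.coeFn_toLp] with t h1 h2
  rw [ContinuousLinearMap.holderL_apply_apply, h1, h2]
  rfl

namespace MulBy

variable {M N : L2Circle H →L[ℂ] L2Circle H} {F G : AddCircle (1 : ℝ) → H →L[ℂ] H}

lemma one : MulBy (1 : L2Circle H →L[ℂ] L2Circle H) 1 := fun _ => .of_forall fun _ => rfl

lemma mul (hM : MulBy M F) (hN : MulBy N G) : MulBy (M * N) (F * G) := fun f => by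
  filter_upwards [hM (N f), hN f] with t h1 h2
  rw [mul_apply_eq_comp, h1, h2]
  rfl

lemma add (hM : MulBy M F) (hN : MulBy N G) : MulBy (M + N) (F + G) := fun f => by
  filter_upwards [hM f, hN f, Lp.coeFn_add (M f) (N f)] with t h1 h2 h3
  rw [add_apply, h3, Pi.add_apply, h1, h2]
  rfl

lemma const_smul (hM : MulBy M F) (c : ℂ) : MulBy (c • M) (c • F) := fun f => by
  filter_upwards [hM f, Lp.coeFn_smul c (M f)] with t h1 h2
  rw [smul_apply, h2, Pi.smul_apply, h1]
  rfl

lemma eq_of_ae (hM : MulBy M F) (hN : MulBy N G)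
    (h : ∀ᵐ t ∂(AddCircle.haarAddCircle (T := (1 : ℝ))), F t = G t) : M = N := by
  ext1 f
  apply Lp.ext
  filter_upwards [hM f, hN f, h] with t h1 h2 h3
  rw [h1, h2, h3]

lemma star_eq [CompleteSpace H] (hM : MulBy M F) (hN : MulBy N fun t => star (F t)) :
    star M = N := by
  rw [ContinuousLinearMap.star_eq_adjoint, eq_comm, ContinuousLinearMap.eq_adjoint_iff]
  intro f g
  rw [L2.inner_def, L2.inner_def]
  refine integral_congr_ae ?_
  filter_upwards [hM g, hN f] with t h1 h2
  rw [h1, h2, ContinuousLinearMap.star_eq_adjoint, ContinuousLinearMap.adjoint_inner_left]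

end MulBy

/-- The isometric embedding of `H` into `L²(𝕋; H)` as the constant functions. -/
def constEmbedding (H : Type*) [NormedAddCommGroup H] [InnerProductSpace ℂ H] :
    H →ₗᵢ[ℂ] L2Circle H where
  toLinearMap := Lp.constₗ 2 (AddCircle.haarAddCircle (T := (1 : ℝ))) ℂ
  norm_map' h := by
    simp [Lp.norm_const']

lemma coeFn_constEmbedding (h : H) : ∀ᵐ t ∂(AddCircle.haarAddCircle (T := (1 : ℝ))),
    constEmbedding H h t = h :=
  Lp.coeFn_const 2 _ h

/-- The compression of a multiplication operator to the constant functions is the mean of its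
symbol. -/
lemma MulBy.compression_eq_integral [CompleteSpace H] {M : L2Circle H →L[ℂ] L2Circle H}
    {F : AddCircle (1 : ℝ) → H →L[ℂ] H} (hM : MulBy M F)
    (hF : Integrable F (AddCircle.haarAddCircle (T := (1 : ℝ)))) :
    ContinuousLinearMap.adjoint (constEmbedding H).toContinuousLinearMap ∘L M ∘L
      (constEmbedding H).toContinuousLinearMap =
      ∫ t, F t ∂(AddCircle.haarAddCircle (T := (1 : ℝ))) := by
  ext h
  refine ext_inner_left ℂ fun k => ?_
  rw [ContinuousLinearMap.comp_apply, ContinuousLinearMap.adjoint_inner_right, L2.inner_def,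
    ContinuousLinearMap.integral_apply hF, ← integral_inner (hF.apply_continuousLinearMap h)]
  refine integral_congr_ae ?_
  filter_upwards [coeFn_constEmbedding k, hM (constEmbedding H h), coeFn_constEmbedding h]
    with t h1 h2 h3
  simp only [LinearIsometry.coe_toContinuousLinearMap, ContinuousLinearMap.comp_apply]
  rw [h1, h2, h3]

end MultiplicationOperators

/-! ### Spectral projections and polar decomposition -/

section Spectral

variable {H : Type*} [NormedAddCommGroup H] [InnerProductSpace ℂ H] [CompleteSpace H]

/-- The spectrum being finite, indicator functions of points are continuous on it, and the
functional calculus yields the spectral projections. -/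
lemma isSpectralFamily_cfc {D : H →L[ℂ] H} (hD : IsStarNormal D) (hfin : (spectrum ℂ D).Finite) :
    IsSpectralFamily D hfin.toFinset (fun l => cfc (fun z => if z = l then (1 : ℂ) else 0) D) := by
  have hcont : ∀ f : ℂ → ℂ, ContinuousOn f (spectrum ℂ D) := fun f => hfin.continuousOn f
  refine ⟨fun l _ => ⟨?_, ?_⟩, fun l _ k _ hlk => ?_, ?_, ?_⟩
  · rw [IsIdempotentElem, ← cfc_mul _ _ D (hcont _) (hcont _)]
    congr 1
    ext z
    split_ifs <;> simp
  · rw [IsSelfAdjoint, ← cfc_star]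
    congr 1
    ext z
    split_ifs <;> simp
  · rw [← cfc_mul _ _ D (hcont _) (hcont _), ← cfc_zero ℂ D]
    congr 1
    ext z
    by_cases h : z = l <;> simp [h, hlk]
  · rw [← cfc_sum _ _ _ fun _ _ => hcont _, ← cfc_one ℂ D]
    refine cfc_congr fun z hz => ?_
    simpa using hz
  · rw [Finset.sum_congr rfl fun l _ => (cfc_smul l _ D (hcont _)).symm,
      ← cfc_sum _ _ _ fun _ _ => hcont _]
    conv_lhs => rw [← cfc_id ℂ D]
    refine cfc_congr fun z hz => ?_
    simpa using fun h => absurd hz h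

namespace IsSpectralFamily

variable {D : H →L[ℂ] H} {σ : Finset ℂ} {P : ℂ → H →L[ℂ] H}

lemma sum_mul_sum (hP : IsSpectralFamily D σ P) (c c' : ℂ → ℂ) :
    (∑ l ∈ σ, c l • P l) * ∑ l ∈ σ, c' l • P l = ∑ l ∈ σ, (c l * c' l) • P l := by
  rw [Finset.sum_mul_sum]
  refine Finset.sum_congr rfl fun l hl => ?_
  rw [Finset.sum_eq_single_of_mem l hl fun k hk hkl => by
    rw [smul_mul_smul_comm, hP.orthogonal l hl k hk hkl.symm, smul_zero]]
  rw [smul_mul_smul_comm, (hP.proj l hl).isIdempotentElem.eq]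

lemma star_sum (hP : IsSpectralFamily D σ P) (c : ℂ → ℂ) :
    star (∑ l ∈ σ, c l • P l) = ∑ l ∈ σ, star (c l) • P l := by
  rw [_root_.star_sum]
  refine Finset.sum_congr rfl fun l hl => ?_
  rw [star_smul, (hP.proj l hl).isSelfAdjoint.star_eq]

lemma sum_inv_mul_sum (hP : IsSpectralFamily D σ P) {c : ℂ → ℂ} (hc : ∀ l, c l ≠ 0) :
    (∑ l ∈ σ, (c l)⁻¹ • P l) * ∑ l ∈ σ, c l • P l = 1 := by
  rw [hP.sum_mul_sum, ← hP.sum_eq_one]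
  exact Finset.sum_congr rfl fun l _ => by rw [inv_mul_cancel₀ (hc l), one_smul]

lemma sum_mul_sum_inv (hP : IsSpectralFamily D σ P) {c : ℂ → ℂ} (hc : ∀ l, c l ≠ 0) :
    (∑ l ∈ σ, c l • P l) * ∑ l ∈ σ, (c l)⁻¹ • P l = 1 := by
  rw [hP.sum_mul_sum, ← hP.sum_eq_one]
  exact Finset.sum_congr rfl fun l _ => by rw [mul_inv_cancel₀ (hc l), one_smul]

lemma isStarProjection_sum (hP : IsSpectralFamily D σ P) {c : ℂ → ℂ}
    (hc : ∀ l, IsStarProjection (c l)) : IsStarProjection (∑ l ∈ σ, c l • P l) := by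
  refine ⟨?_, ?_⟩
  · rw [IsIdempotentElem, hP.sum_mul_sum]
    exact Finset.sum_congr rfl fun l _ => by rw [(hc l).isIdempotentElem.eq]
  · rw [IsSelfAdjoint, hP.star_sum]
    exact Finset.sum_congr rfl fun l _ => by rw [(hc l).isSelfAdjoint.star_eq]

end IsSpectralFamily

lemma isSelfAdjoint_absOp (T : H →L[ℂ] H) : IsSelfAdjoint (absOp T) :=
  (CFC.sqrt_nonneg _).isSelfAdjoint

lemma absOp_mul_self (T : H →L[ℂ] H) : absOp T * absOp T = star T * T :=
  CFC.sqrt_mul_sqrt_self _ (star_mul_self_nonneg T)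

lemma isUnit_absOp {T : H →L[ℂ] H} (hT : IsUnit T) : IsUnit (absOp T) := by
  have : IsUnit (absOp T * absOp T) := absOp_mul_self T ▸ hT.star.mul hT
  exact ((Commute.refl (absOp T)).isUnit_mul_iff.1 this).1

lemma polarFactor_mul_absOp {T : H →L[ℂ] H} (hT : IsUnit T) : polarFactor T * absOp T = T := by
  rw [polarFactor, mul_assoc, Ring.inverse_mul_cancel _ (isUnit_absOp hT), mul_one]

lemma star_polarFactor_mul_self {T : H →L[ℂ] H} (hT : IsUnit T) :
    star (polarFactor T) * polarFactor T = 1 := by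
  have hD := isUnit_absOp hT
  have hs : star (Ring.inverse (absOp T)) = Ring.inverse (absOp T) := by
    rw [← Ring.inverse_star, (isSelfAdjoint_absOp T).star_eq]
  rw [polarFactor, star_mul, hs, mul_assoc, ← mul_assoc (star T), ← absOp_mul_self, mul_assoc,
    Ring.mul_inverse_cancel _ hD, mul_one, Ring.inverse_mul_cancel _ hD]

lemma self_mul_star_polarFactor {T : H →L[ℂ] H} (hT : IsUnit T) :
    polarFactor T * star (polarFactor T) = 1 := by
  have hU : IsUnit (polarFactor T) := hT.mul (isUnit_absOp hT).ringInverse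
  refine hU.mul_right_cancel ?_
  rw [mul_assoc, star_polarFactor_mul_self hT, mul_one, one_mul]

lemma symbol_eq (T : H →L[ℂ] H) (σ : Finset ℂ) (P : ℂ → H →L[ℂ] H) (v w : ℂ → ℂ) (z : ℂ) :
    symbol T σ P v w z = polarFactor T * ∑ l ∈ σ, v (diskAut (w l) z) • P l := by
  rw [symbol, Finset.mul_sum]
  exact Finset.sum_congr rfl fun l _ => (mul_smul_comm _ _ _).symm

/-- The values of the symbol are invertible, being products of the unitary polar factor with
invertible functions of `(T* T)^{1/2}`. -/
def symbolUnit {T : H →L[ℂ] H} (hT : IsUnit T) {σ : Finset ℂ} {P : ℂ → H →L[ℂ] H}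
    (hP : IsSpectralFamily (absOp T) σ P) {v : ℂ → ℂ} (hv : ∀ z, v z ≠ 0) (w : ℂ → ℂ) (z : ℂ) :
    (H →L[ℂ] H)ˣ where
  val := symbol T σ P v w z
  inv := (∑ l ∈ σ, (v (diskAut (w l) z))⁻¹ • P l) * star (polarFactor T)
  val_inv := by
    rw [symbol_eq, mul_assoc, ← mul_assoc (∑ l ∈ σ, _),
      hP.sum_mul_sum_inv fun l => hv (diskAut (w l) z), one_mul, self_mul_star_polarFactor hT]
  inv_val := by
    rw [symbol_eq, mul_assoc, ← mul_assoc (star _), star_polarFactor_mul_self hT, one_mul,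
      hP.sum_inv_mul_sum fun l => hv (diskAut (w l) z)]

lemma symbol_zero {T : H →L[ℂ] H} (hT : IsUnit T) {σ : Finset ℂ} {P : ℂ → H →L[ℂ] H}
    (hP : IsSpectralFamily (absOp T) σ P) {v w : ℂ → ℂ} (hw : ∀ l ∈ σ, v (w l) = l) :
    symbol T σ P v w 0 = T := by
  rw [symbol_eq]
  conv_rhs => rw [← polarFactor_mul_absOp hT, hP.eq_sum]
  congr 1
  exact Finset.sum_congr rfl fun l hl => by rw [diskAut_zero_right, hw l hl]

lemma star_symbol_mul_symbol {T : H →L[ℂ] H} (hT : IsUnit T) {σ : Finset ℂ} {P : ℂ → H →L[ℂ] H}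
    (hP : IsSpectralFamily (absOp T) σ P) (v w : ℂ → ℂ) (z : ℂ) :
    star (symbol T σ P v w z) * symbol T σ P v w z =
      ∑ l ∈ σ, ((‖v (diskAut (w l) z)‖ : ℂ) ^ 2) • P l := by
  rw [symbol_eq, star_mul, mul_assoc, ← mul_assoc (star (polarFactor T)),
    star_polarFactor_mul_self hT, one_mul, hP.star_sum,
    hP.sum_mul_sum (fun l => star (v (diskAut (w l) z))) fun l => v (diskAut (w l) z)]
  refine Finset.sum_congr rfl fun l _ => ?_
  congr 1
  exact conj_mul' _

/-- The symbol formed with functions of `(T* T)^{1/2}` as coefficients lies in the algebra generated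
by `T`, `T*` and `((T* T)^{1/2})⁻¹`, so it inherits the commutation relations of `T` and `T*`. -/
lemma commute_symbol_cfc {X T : H →L[ℂ] H} (h : Commute X T) (h' : Commute X (star T))
    (hT : IsUnit T) (σ : Finset ℂ) (f : ℂ → ℂ → ℂ) (v w : ℂ → ℂ) (z : ℂ) :
    Commute X (symbol T σ (fun l => cfc (f l) (absOp T)) v w z) := by
  have hD : Commute X (absOp T) := by
    rw [absOp, CFC.sqrt_eq_cfc]
    exact ((h'.mul_right h).symm.cfc_nnreal _).symm
  have hU : Commute X (polarFactor T) := by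
    refine h.mul_right ?_
    obtain ⟨u, hu⟩ := isUnit_absOp hT
    rw [← hu] at hD ⊢
    rw [Ring.inverse_unit]
    exact hD.units_inv_right
  refine Commute.sum_right _ _ _ fun l _ => Commute.smul_right (hU.mul_right ?_) _
  exact ((isSelfAdjoint_absOp T).commute_cfc hD.symm _).symm

end Spectral

/-! ### The dilating multiplication operators -/

section Dilation

variable {H : Type*} [NormedAddCommGroup H] [InnerProductSpace ℂ H]

lemma IsBddAnalytic.exists_bound_toCircle {f : ℂ → H →L[ℂ] H} (hf : IsBddAnalytic f) :
    ∃ C, ∀ t : AddCircle (1 : ℝ), ‖f (AddCircle.toCircle t)‖ ≤ C :=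
  hf.bounded.imp fun _ hC _ => hC _ (by simp [Circle.norm_coe])

lemma IsBddAnalytic.exists_mulBy {f : ℂ → H →L[ℂ] H} (hf : IsBddAnalytic f) :
    ∃ M : L2Circle H →L[ℂ] L2Circle H, MulBy M fun t => f (AddCircle.toCircle t) :=
  let ⟨_, hC⟩ := hf.exists_bound_toCircle
  AnnulusDilation.exists_mulBy hf.aestronglyMeasurable hC

/-- The group of pairs of an invertible multiplication operator on `L²(𝕋; H)` and a symbol for it
which, together with its inverse, is bounded and analytic in the disk. -/
def analyticMultiplierGroup (H : Type*) [NormedAddCommGroup H] [InnerProductSpace ℂ H] :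
    Subgroup ((L2Circle H →L[ℂ] L2Circle H)ˣ × (ℂ → (H →L[ℂ] H)ˣ)) where
  carrier := {x | (IsBddAnalytic (fun z => (x.2 z : H →L[ℂ] H)) ∧
      IsBddAnalytic (fun z => ((x.2 z)⁻¹ : (H →L[ℂ] H)ˣ) : ℂ → H →L[ℂ] H)) ∧
    MulBy (x.1 : L2Circle H →L[ℂ] L2Circle H)
      (fun t => (x.2 (AddCircle.toCircle t) : H →L[ℂ] H)) ∧
    MulBy ((x.1⁻¹ : (L2Circle H →L[ℂ] L2Circle H)ˣ) : L2Circle H →L[ℂ] L2Circle H)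
      (fun t => ((x.2 (AddCircle.toCircle t))⁻¹ : (H →L[ℂ] H)ˣ))}
  one_mem' := ⟨⟨.const 1, by simpa using .const (1 : H →L[ℂ] H)⟩, .one,
    by simpa using! MulBy.one (H := H)⟩
  mul_mem' := by
    rintro x y ⟨⟨h1, h2⟩, h3, h4⟩ ⟨⟨k1, k2⟩, k3, k4⟩
    refine ⟨⟨h1.mul k1, ?_⟩, h3.mul k3, ?_⟩
    · simpa [mul_inv_rev] using k2.mul h2
    · simpa [mul_inv_rev] using! k4.mul h4
  inv_mem' := by
    rintro x ⟨⟨h1, h2⟩, h3, h4⟩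
    exact ⟨⟨h2, by simpa using h1⟩, h4, by simpa using h3⟩

lemma exists_mem_analyticMultiplierGroup {F : ℂ → (H →L[ℂ] H)ˣ}
    (hF : IsBddAnalytic fun z => (F z : H →L[ℂ] H))
    (hF' : IsBddAnalytic (fun z => ((F z)⁻¹ : (H →L[ℂ] H)ˣ) : ℂ → H →L[ℂ] H)) :
    ∃ M : (L2Circle H →L[ℂ] L2Circle H)ˣ, (M, F) ∈ analyticMultiplierGroup H := by
  obtain ⟨M, hM⟩ := hF.exists_mulBy
  obtain ⟨N, hN⟩ := hF'.exists_mulBy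
  exact ⟨⟨M, N, (hM.mul hN).eq_of_ae .one (.of_forall fun t => by simp),
    (hN.mul hM).eq_of_ae .one (.of_forall fun t => by simp)⟩, ⟨hF, hF'⟩, hM, hN⟩

variable [CompleteSpace H]

/-- Compressing an analytic multiplication operator to the constants evaluates its symbol at the
centre of the disk; as the symbols form a group, the same holds for monomials. -/
lemma isDilation_of_mem_analyticMultiplierGroup {d : ℕ} {T : Fin d → (H →L[ℂ] H)ˣ}
    {F : Fin d → ℂ → (H →L[ℂ] H)ˣ} {M : Fin d → (L2Circle H →L[ℂ] L2Circle H)ˣ}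
    (hM : ∀ j, (M j, F j) ∈ analyticMultiplierGroup H) (hF : ∀ j, F j 0 = T j) :
    IsDilation (constEmbedding H) T M := by
  intro n
  set x : (L2Circle H →L[ℂ] L2Circle H)ˣ × (ℂ → (H →L[ℂ] H)ˣ) :=
    (List.ofFn fun j => (M j, F j) ^ n j).prod with hx
  have hmem : x ∈ analyticMultiplierGroup H := by
    refine list_prod_mem fun y hy => ?_
    obtain ⟨j, rfl⟩ := List.mem_ofFn.1 hy
    exact zpow_mem (hM j) _
  have h1 : (x.1 : L2Circle H →L[ℂ] L2Circle H) = intMonomial M n := by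
    have := map_list_prod (MonoidHom.fst (L2Circle H →L[ℂ] L2Circle H)ˣ (ℂ → (H →L[ℂ] H)ˣ))
      (List.ofFn fun j => (M j, F j) ^ n j)
    rw [List.map_ofFn] at this
    exact congrArg Units.val this
  have h2 : (x.2 0 : H →L[ℂ] H) = intMonomial T n := by
    have := map_list_prod ((Pi.evalMonoidHom (fun _ : ℂ => (H →L[ℂ] H)ˣ) 0).comp
      (MonoidHom.snd (L2Circle H →L[ℂ] L2Circle H)ˣ (ℂ → (H →L[ℂ] H)ˣ)))
      (List.ofFn fun j => (M j, F j) ^ n j)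
    rw [List.map_ofFn] at this
    simp only [Function.comp_def, MonoidHom.comp_apply, MonoidHom.coe_snd, Prod.pow_snd,
      Pi.evalMonoidHom_apply, Pi.pow_apply, hF] at this
    exact congrArg Units.val this
  obtain ⟨⟨hA, -⟩, hB, -⟩ := hmem
  obtain ⟨C, hC⟩ := hA.exists_bound_toCircle
  rw [← h1, ← h2, hB.compression_eq_integral
    (.of_bound hA.aestronglyMeasurable C (.of_forall hC)), hA.integral_eq]

lemma MulBy.isStarProjection {M : L2Circle H →L[ℂ] L2Circle H}
    {F : AddCircle (1 : ℝ) → H →L[ℂ] H} (hM : MulBy M F) (hF : ∀ t, IsStarProjection (F t)) :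
    IsStarProjection M where
  isIdempotentElem := (hM.mul hM).eq_of_ae hM (.of_forall fun t => (hF t).isIdempotentElem)
  isSelfAdjoint := hM.star_eq (by simpa only [(hF _).isSelfAdjoint.star_eq] using hM)

lemma MulBy.star {M : L2Circle H →L[ℂ] L2Circle H} {f : ℂ → H →L[ℂ] H} (hf : IsBddAnalytic f)
    (hM : MulBy M fun t => f (AddCircle.toCircle t)) :
    MulBy (star M) fun t => star (f (AddCircle.toCircle t)) := by
  obtain ⟨C, hC⟩ := hf.exists_bound_toCircle
  obtain ⟨N, hN⟩ := AnnulusDilation.exists_mulBy hf.aestronglyMeasurable.star (C := C)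
    fun t => (norm_star _).trans_le (hC t)
  rwa [hM.star_eq hN]

variable {r : ℝ} {T : H →L[ℂ] H} {σ : Finset ℂ} {P : ℂ → H →L[ℂ] H} {w : ℂ → ℂ}

lemma isBddAnalytic_annulusCover (hr₀ : 0 < r) (hr₁ : r < 1) {w : ℂ} (hw : ‖w‖ < 1) :
    IsBddAnalytic fun z => annulusCover r (diskAut w z) :=
  isBddAnalytic_comp_diskAut (differentiableOn_annulusCover r) (continuousOn_annulusCover r)
    (fun _ hz => (norm_annulusCover_mem hr₀ hr₁ hz).2) hw

lemma isBddAnalytic_annulusCover_inv (hr₀ : 0 < r) (hr₁ : r < 1) {w : ℂ} (hw : ‖w‖ < 1) :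
    IsBddAnalytic fun z => (annulusCover r (diskAut w z))⁻¹ :=
  isBddAnalytic_comp_diskAut (f := fun z => (annulusCover r z)⁻¹)
    ((differentiableOn_annulusCover r).inv fun z _ => annulusCover_ne_zero r z)
    ((continuousOn_annulusCover r).inv₀ fun z _ => annulusCover_ne_zero r z)
    (fun _ hz => (norm_inv _).trans_le
      (inv_anti₀ hr₀ (norm_annulusCover_mem hr₀ hr₁ hz).1)) hw

lemma isBddAnalytic_symbol (hr₀ : 0 < r) (hr₁ : r < 1) (hw : ∀ l ∈ σ, ‖w l‖ < 1) :
    IsBddAnalytic (symbol T σ P (annulusCover r) w) :=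
  IsBddAnalytic.sum fun l hl => (isBddAnalytic_annulusCover hr₀ hr₁ (hw l hl)).smul_const _

lemma isBddAnalytic_symbolUnit_inv (hr₀ : 0 < r) (hr₁ : r < 1) (hw : ∀ l ∈ σ, ‖w l‖ < 1)
    (hT : IsUnit T) (hP : IsSpectralFamily (absOp T) σ P) :
    IsBddAnalytic (fun z => ((symbolUnit hT hP (annulusCover_ne_zero r) w z)⁻¹ :
      (H →L[ℂ] H)ˣ) : ℂ → H →L[ℂ] H) :=
  (IsBddAnalytic.sum fun l hl =>
    (isBddAnalytic_annulusCover_inv hr₀ hr₁ (hw l hl)).smul_const (P l)).mul (.const _)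

/-- On the circle the covering map has modulus `1` or `r`, so `F* F = P₀ + r² P₁`, where
`P₀(ζ)` adds up the spectral projections `P_λ` for which `|v(φ_λ(ζ))| = 1`. -/
lemma memCalC1r_of_mulBy (hr₀ : 0 < r) (hr₁ : r < 1) (hw : ∀ l ∈ σ, ‖w l‖ < 1)
    (hT : IsUnit T) (hP : IsSpectralFamily (absOp T) σ P) {M : L2Circle H →L[ℂ] L2Circle H}
    (hM : MulBy M fun t => symbol T σ P (annulusCover r) w (AddCircle.toCircle t)) :
    MemCalC1r r M := by
  classical
  set c : ℂ → AddCircle (1 : ℝ) → ℂ := fun l t =>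
    if ‖annulusCover r (diskAut (w l) (AddCircle.toCircle t))‖ = 1 then 1 else 0 with hc
  have hmeas : ∀ l, Measurable (c l) := fun l => by
    have h1 : Measurable fun t : AddCircle (1 : ℝ) =>
        ‖annulusCover r (diskAut (w l) (AddCircle.toCircle t))‖ :=
      ((measurable_annulusCover r).comp ((measurable_diskAut (w l)).comp
        (continuous_subtype_val.comp AddCircle.continuous_toCircle).measurable)).norm
    exact Measurable.ite (h1 (measurableSet_singleton 1)) measurable_const measurable_const
  have hE : AEStronglyMeasurable (fun t => ∑ l ∈ σ, c l t • P l)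
      (AddCircle.haarAddCircle (T := (1 : ℝ))) :=
    Finset.aestronglyMeasurable_fun_sum σ fun l _ =>
      ((hmeas l).aestronglyMeasurable).smul_const (P l)
  obtain ⟨P₀, hP₀⟩ := exists_mulBy hE (C := ∑ l ∈ σ, ‖P l‖) fun t => by
    refine (norm_sum_le _ _).trans (Finset.sum_le_sum fun l _ => ?_)
    rw [norm_smul]
    refine mul_le_of_le_one_left (norm_nonneg _) ?_
    simp only [hc]
    split_ifs <;> simp
  have hproj : IsStarProjection P₀ := hP₀.isStarProjection fun t =>
    hP.isStarProjection_sum fun l => by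
      simp only [hc]
      split_ifs
      exacts [.one _, .zero _]
  refine ⟨P₀, 1 - P₀, hproj, hproj.one_sub, add_sub_cancel _ _, ?_⟩
  have hP₁ : MulBy (1 - P₀) (fun t => ∑ l ∈ σ, (1 - c l t) • P l) := by
    have h := MulBy.one.add (hP₀.const_smul (-1))
    rw [neg_one_smul, ← sub_eq_add_neg] at h
    convert h using 1
    ext1 t
    simp only [sub_smul, one_smul, Finset.sum_sub_distrib, hP.sum_eq_one]
    simp [sub_eq_add_neg]
  refine ((hM.star (isBddAnalytic_symbol hr₀ hr₁ hw)).mul hM).eq_of_ae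
    (hP₀.add (hP₁.const_smul ((r : ℂ) ^ 2))) ?_
  have hae : ∀ᵐ t ∂(AddCircle.haarAddCircle (T := (1 : ℝ))), ∀ l ∈ σ,
      diskAut (w l) (AddCircle.toCircle t) ≠ 1 ∧ diskAut (w l) (AddCircle.toCircle t) ≠ -1 :=
    (eventually_all_finset σ).2 fun l hl =>
      (ae_diskAut_toCircle_ne (hw l hl) 1).and (ae_diskAut_toCircle_ne (hw l hl) (-1))
  filter_upwards [hae] with t ht
  simp only [Pi.mul_apply, Pi.add_apply, Pi.smul_apply, star_symbol_mul_symbol hT hP,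
    Finset.smul_sum, ← Finset.sum_add_distrib, smul_smul, ← add_smul]
  refine Finset.sum_congr rfl fun l hl => ?_
  congr 1
  have hn : ‖diskAut (w l) (AddCircle.toCircle t)‖ = 1 :=
    norm_diskAut_eq_one (hw l hl) (Circle.norm_coe _)
  rcases norm_annulusCover_of_norm_eq_one hr₀ hn (ht l hl).1 (ht l hl).2 with h | h
  · simp [hc, h, hr₁.ne]
  · simp [hc, h]

end Dilation

end AnnulusDilation

open AnnulusDilation in
theorem theorem2p5 {H : Type*} [NormedAddCommGroup H] [InnerProductSpace ℂ H] [CompleteSpace H]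
    (r : ℝ) (hr₀ : 0 < r) (hr₁ : r < 1) {d : ℕ} (T : Fin d → (H →L[ℂ] H)ˣ)
    (hT : ∀ j, AnnulusDilation.MemC1r r (T j))
    (hdc : AnnulusDilation.DoublyCommuting fun j => (T j : H →L[ℂ] H))
    (hfin : ∀ j, (spectrum ℂ (AnnulusDilation.absOp (T j : H →L[ℂ] H))).Finite)
    (hsub : ∀ j, spectrum ℂ (AnnulusDilation.absOp (T j : H →L[ℂ] H)) ⊆
      (fun x : ℝ => (x : ℂ)) '' Set.Ioo r 1) :
    ∃ (v : ℂ → ℂ) (w : Fin d → ℂ → ℂ) (P : Fin d → ℂ → (H →L[ℂ] H))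
      (V : H →ₗᵢ[ℂ] AnnulusDilation.L2Circle H)
      (M : Fin d → (AnnulusDilation.L2Circle H →L[ℂ] AnnulusDilation.L2Circle H)ˣ),
      AnnulusDilation.IsDiskAnnulusMap r v ∧
      (∀ j, ∀ l ∈ (hfin j).toFinset, w j l ∈ Metric.ball (0 : ℂ) 1 ∧ v (w j l) = l) ∧
      (∀ j, AnnulusDilation.IsSpectralFamily (AnnulusDilation.absOp (T j : H →L[ℂ] H))
        (hfin j).toFinset (P j)) ∧
      (∀ h : H, ∀ᵐ t ∂(AddCircle.haarAddCircle (T := (1 : ℝ))), V h t = h) ∧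
      (∀ j, AnnulusDilation.IsMultiplicationBy (M j : AnnulusDilation.L2Circle H →L[ℂ] _)
        (AnnulusDilation.symbol (T j : H →L[ℂ] H) (hfin j).toFinset (P j) v (w j))) ∧
      (AnnulusDilation.DoublyCommuting fun j =>
        (M j : AnnulusDilation.L2Circle H →L[ℂ] AnnulusDilation.L2Circle H)) ∧
      (∀ j, AnnulusDilation.MemCalC1r r
        (M j : AnnulusDilation.L2Circle H →L[ℂ] AnnulusDilation.L2Circle H)) ∧
      AnnulusDilation.IsDilation V T M := by
  have hv := isDiskAnnulusMap_annulusCover hr₀ hr₁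
  have hex : ∀ j, ∀ l ∈ (hfin j).toFinset, ∃ z ∈ Metric.ball (0 : ℂ) 1, annulusCover r z = l := by
    intro j l hl
    obtain ⟨x, hx, rfl⟩ := hsub j ((hfin j).mem_toFinset.1 hl)
    have hmem : (x : ℂ) ∈ annulus r := by
      simpa [annulus, abs_of_pos (hr₀.trans hx.1)] using hx
    rwa [← hv.image_disk] at hmem
  choose! w hw hvw using hex
  have hw' : ∀ j, ∀ l ∈ (hfin j).toFinset, ‖w j l‖ < 1 := fun j l hl => by
    simpa using hw j l hl
  have hTu : ∀ j, IsUnit (T j : H →L[ℂ] H) := fun j => (T j).isUnit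
  have hP := fun j => isSpectralFamily_cfc (isSelfAdjoint_absOp (T j : H →L[ℂ] H)).isStarNormal
    (hfin j)
  have hF := fun j => isBddAnalytic_symbol (T := (T j : H →L[ℂ] H))
    (P := fun l => cfc (fun z => if z = l then (1 : ℂ) else 0) (absOp (T j : H →L[ℂ] H)))
    hr₀ hr₁ (hw' j)
  choose M hM using fun j => exists_mem_analyticMultiplierGroup
    (F := symbolUnit (hTu j) (hP j) (annulusCover_ne_zero r) (w j)) (hF j)
    (isBddAnalytic_symbolUnit_inv hr₀ hr₁ (hw' j) (hTu j) (hP j))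
  have hmul : ∀ j, MulBy (M j : L2Circle H →L[ℂ] L2Circle H) fun t =>
    symbol (T j : H →L[ℂ] H) (hfin j).toFinset
      (fun l => cfc (fun z => if z = l then (1 : ℂ) else 0) (absOp (T j : H →L[ℂ] H)))
      (annulusCover r) (w j) (AddCircle.toCircle t) := fun j => (hM j).2.1
  refine ⟨annulusCover r, w, _, constEmbedding H, M, hv, fun j l hl => ⟨hw j l hl, hvw j l hl⟩, hP,
    coeFn_constEmbedding, hmul, ?_, fun j => memCalC1r_of_mulBy hr₀ hr₁ (hw' j) (hTu j) (hP j)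
      (hmul j), isDilation_of_mem_analyticMultiplierGroup hM fun j =>
        Units.ext (symbol_zero (hTu j) (hP j) (hvw j))⟩
  intro i j hij
  have h1 : Commute (T i : H →L[ℂ] H) (T j) := (hdc i j hij).1
  have h2 : Commute (T i : H →L[ℂ] H) (star (T j : H →L[ℂ] H)) := (hdc i j hij).2
  -- commutation passes from `T i` to its symbol, and then from `T j` to its symbol
  have hs : ∀ z, Commute (T j : H →L[ℂ] H) _ ∧ Commute (star (T j : H →L[ℂ] H)) _ := fun z =>
    ⟨commute_symbol_cfc h1.symm (by simpa using h2.star_star.symm) (hTu i) (hfin i).toFinset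
        (fun l z => if z = l then (1 : ℂ) else 0) (annulusCover r) (w i) z,
      commute_symbol_cfc h2.symm h1.symm.star_star (hTu i) (hfin i).toFinset
        (fun l z => if z = l then (1 : ℂ) else 0) (annulusCover r) (w i) z⟩
  refine ⟨((hmul i).mul (hmul j)).eq_of_ae ((hmul j).mul (hmul i)) (.of_forall fun t => ?_), ?_⟩
  · exact commute_symbol_cfc (hs _).1.symm (hs _).2.symm (hTu j) _ _ _ _ _
  · have hstar := (hmul j).star (hF j)
    refine ((hmul i).mul hstar).eq_of_ae (hstar.mul (hmul i)) (.of_forall fun t => ?_)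
    obtain ⟨k1, k2⟩ := hs (AddCircle.toCircle t)
    have h := commute_symbol_cfc (by simpa only [star_star] using k2.symm.star_star)
      k1.symm.star_star (hTu j) (hfin j).toFinset (fun l z => if z = l then (1 : ℂ) else 0)
      (annulusCover r) (w j) (AddCircle.toCircle t)
    simpa only [star_star] using! h.star_star

end
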